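/- Let $R$ be an irreducible reduced crystallographic root system (the roots of a finite-dimensional complex simple Lie algebra) with simple roots $\{\alpha_i\}_{i\in I}$, let $Q^+$ be the $\mathbb Z_{\ge 0}$-span of the simple roots, and let $R^+=R\cap Q^+$. Let $W$ be the Weyl group, with simple reflections $s_i$, and let $A=(a_{ij})_{i,j\in I}$ be the Cartan matrix, normalized by $s_i(\alpha_j)=\alpha_j-a_{ij}\alpha_i$. Let $(d_i)_{i\in I}$ be the relatively prime positive integers such that the matrix $(d_ia_{ij})$ is symmetric. Let $q\in\mathbb C^\times$ not be a root of unity, and put $q_i=q^{d_i}$. Let $\mathcal P$ be the group, under coordinatewise multiplication, of $I$-tuples $\varpi=(\varpi_i)_{i\in I}$ of rational functions $\varpi_i\in\mathbb C(u)$ that are quotients of polynomials with constant term one. For $i\in I$ and $a\in\mathbb C^\times$ let $\pi_{i,a}\in\mathcal P$ have $i$-th coordinate $1-au$ and all other coordinates $1$. For $i\in I$ the generator $\tilde T_i$ of the braid group of $W$ acts on $\mathcal P$ by $$(\tilde T_i\varpi)_i=\frac1{\varpi_i(q_i^2u)},\qquad (\tilde T_i\varpi)_j=\begin{cases}\varpi_j(u)&\text{if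 } a_{ji}=0,\\ \varpi_j(u)\,\varpi_i(q_iu)&\text{if } a_{ji}=-1,\\ \varpi_j(u)\,\varpi_i(q^3u)\,\varpi_i(qu)&\text{if } a_{ji}=-2,\\ \varpi_j(u)\,\varpi_i(q^5u)\,\varpi_i(q^3u)\,\varpi_i(qu)&\text{if } a_{ji}=-3\end{cases}\qquad(j\neq i).$$ For $w\in W$ put $\tilde T_w=\tilde T_{i_1}\cdots\tilde T_{i_k}$, where $w=s_{i_1}\cdots s_{i_k}$ is a reduced expression. Define the $\ell$-roots $\boldsymbol\alpha_{i,a}=(\tilde T_i\pi_{i,a})^{-1}\pi_{i,a}$, and let $\mathcal Q^+\subset\mathcal P$ be the monoid generated by all $\boldsymbol\alpha_{i,a}$ with $i\in I$, $a\in\mathbb C^\times$. Let $w\in W$ and $i\in I$ be such that $w\alpha_i\in R^+$. Then, for every $a\in\mathbb C^\times$ and every reduced expression of $w$ used to form $\tilde T_w$, one has $\tilde T_w\boldsymbol\alpha_{i,a}\in\mathcal Q^+$. -/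

import Mathlib

open Polynomial

noncomputable section

namespace EllRoot

/-! ### Rational functions in `u` and the `ℓ`-weight lattice -/

theorem nonZeroDivisors_le_comap_scale (c : ℂˣ) :
    nonZeroDivisors ℂ[X] ≤
      (nonZeroDivisors ℂ[X]).comap (aeval (C (c : ℂ) * X) : ℂ[X] →ₐ[ℂ] ℂ[X]) := by
  intro p hp
  rw [Submonoid.mem_comap, mem_nonZeroDivisors_iff_ne_zero]
  have hp0 : p ≠ 0 := nonZeroDivisors.ne_zero hp
  have hdeg : (C (c : ℂ) * X : ℂ[X]).natDegree = 1 := natDegree_C_mul_X _ c.ne_zero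
  intro h
  have h2 : p.comp (C (c : ℂ) * X) = 0 := by
    simpa [comp_eq_aeval] using h
  rw [comp_eq_zero_iff] at h2
  rcases h2 with h2 | ⟨_, h2⟩
  · exact hp0 h2
  · rw [h2, natDegree_C] at hdeg
    exact absurd hdeg (by norm_num)

/-- The substitution `f(u) ↦ f(c u)` on the field `ℂ(u)`, for `c ∈ ℂˣ`. -/
def substRatFunc (c : ℂˣ) : RatFunc ℂ →ₐ[ℂ] RatFunc ℂ :=
  RatFunc.mapAlgHom (aeval (C (c : ℂ) * X) : ℂ[X] →ₐ[ℂ] ℂ[X]) (nonZeroDivisors_le_comap_scale c)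

theorem substRatFunc_algebraMap (c : ℂˣ) (p : ℂ[X]) :
    substRatFunc c (algebraMap ℂ[X] (RatFunc ℂ) p) =
      algebraMap ℂ[X] (RatFunc ℂ) (p.comp (C (c : ℂ) * X)) := by
  have h := RatFunc.map_apply_div (aeval (C (c : ℂ) * X) : ℂ[X] →ₐ[ℂ] ℂ[X])
    (nonZeroDivisors_le_comap_scale c) p 1
  rw [map_one, map_one, map_one, div_one, div_one, ← comp_eq_aeval] at h
  exact h

/-- The group of quotients `p / r` of polynomials `p, r ∈ ℂ[u]` with constant term one, as a
subgroup of `ℂ(u)ˣ`. -/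
def unitaryRatFunc : Subgroup (RatFunc ℂ)ˣ where
  carrier := {f | ∃ p r : ℂ[X], p.coeff 0 = 1 ∧ r.coeff 0 = 1 ∧
    (f : RatFunc ℂ) = algebraMap ℂ[X] (RatFunc ℂ) p / algebraMap ℂ[X] (RatFunc ℂ) r}
  one_mem' := ⟨1, 1, by simp, by simp, by simp⟩
  mul_mem' := by
    rintro f g ⟨p, r, hp, hr, hf⟩ ⟨p', r', hp', hr', hg⟩
    refine ⟨p * p', r * r', ?_, ?_, ?_⟩
    · rw [mul_coeff_zero, hp, hp', one_mul]
    · rw [mul_coeff_zero, hr, hr', one_mul]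
    · rw [Units.val_mul, hf, hg, map_mul, map_mul, div_mul_div_comm]
  inv_mem' := by
    rintro f ⟨p, r, hp, hr, hf⟩
    refine ⟨r, p, hr, hp, ?_⟩
    rw [Units.val_inv_eq_inv_val, hf, inv_div]

/-- The substitution `f(u) ↦ f(c u)` on quotients of polynomials with constant term one. -/
def subst (c : ℂˣ) : unitaryRatFunc →* unitaryRatFunc :=
  ((Units.map (substRatFunc c : RatFunc ℂ →* RatFunc ℂ)).comp unitaryRatFunc.subtype).codRestrict
    unitaryRatFunc (by
      rintro ⟨f, p, r, hp, hr, hf⟩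
      refine ⟨p.comp (C (c : ℂ) * X), r.comp (C (c : ℂ) * X), ?_, ?_, ?_⟩
      · simpa [coeff_zero_eq_eval_zero] using hp
      · simpa [coeff_zero_eq_eval_zero] using hr
      · change substRatFunc c (f : RatFunc ℂ) = _
        rw [hf, map_div₀, substRatFunc_algebraMap, substRatFunc_algebraMap])

/-- The `ℓ`-weight lattice `𝒫`: the group, under coordinatewise multiplication, of `I`-tuples of
quotients of polynomials with constant term one. For finite `I` this is the group of fractions of
the monoid `𝒫⁺` of `I`-tuples of polynomials with constant term one. -/
abbrev LWeight (I : Type*) : Type _ := I → unitaryRatFunc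

/-- The polynomial `1 - a u`, as an element of `unitaryRatFunc`. -/
def oneSub (a : ℂˣ) : unitaryRatFunc :=
  ⟨Units.mk0 (algebraMap ℂ[X] (RatFunc ℂ) (1 - C (a : ℂ) * X)) (by
      intro h
      rw [map_eq_zero_iff _ (RatFunc.algebraMap_injective ℂ)] at h
      have := congrArg (fun p : ℂ[X] => p.coeff 0) h
      simp at this),
    ⟨1 - C (a : ℂ) * X, 1, by simp, by simp, by simp⟩⟩

section Operators

variable {I : Type*} [DecidableEq I]

/-- The fundamental `ℓ`-weight `π_{i,a}`: its `i`-th coordinate is `1 - a u`, all others are `1`. -/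
def fundWeight (i : I) (a : ℂˣ) : LWeight I := Pi.mulSingle i (oneSub a)

/-- The factor by which the `j`-th coordinate is multiplied under `T̃_i` for `j ≠ i`, as a function
of `c = a_{ji}`, of `q_i`, and of the `i`-th coordinate `f`: it is `1` if `c = 0`, `f(q_i u)` if
`c = -1`, `f(q³u) f(qu)` if `c = -2`, and `f(q⁵u) f(q³u) f(qu)` if `c = -3`. (An off-diagonal entry
of a Cartan matrix of finite type takes no other value.) -/
def bondFactor (q qi : ℂˣ) (c : ℤ) : unitaryRatFunc →* unitaryRatFunc :=
  if c = -1 then subst qi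
  else if c = -2 then subst (q ^ 3) * subst q
  else if c = -3 then subst (q ^ 5) * subst (q ^ 3) * subst q
  else 1

/-- The operator `T̃_i` on the `ℓ`-weight lattice by which the `i`-th generator of the braid group
acts; here `q_i = q ^ d i`. -/
def braidOp (A : Matrix I I ℤ) (d : I → ℕ) (q : ℂˣ) (i : I) : LWeight I →* LWeight I where
  toFun ϖ j :=
    if j = i then (subst ((q ^ d i) ^ 2) (ϖ i))⁻¹
    else ϖ j * bondFactor q (q ^ d i) (A j i) (ϖ i)
  map_one' := by
    funext j
    by_cases h : j = i <;> simp [h]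
  map_mul' x y := by
    funext j
    by_cases h : j = i
    · simp [h, mul_comm]
    · simp [h, mul_mul_mul_comm]

/-- The operator `T̃_{i₁} ∘ ⋯ ∘ T̃_{iₖ}` on the `ℓ`-weight lattice. -/
def braidWordOp (A : Matrix I I ℤ) (d : I → ℕ) (q : ℂˣ) : List I → (LWeight I →* LWeight I)
  | [] => MonoidHom.id _
  | i :: l => (braidOp A d q i).comp (braidWordOp A d q l)

theorem braidWordOp_nil_apply (A : Matrix I I ℤ) (d : I → ℕ) (q : ℂˣ) (ϖ : LWeight I) :
    braidWordOp A d q [] ϖ = ϖ := rfl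

theorem braidWordOp_cons_apply (A : Matrix I I ℤ) (d : I → ℕ) (q : ℂˣ) (i : I) (l : List I)
    (ϖ : LWeight I) :
    braidWordOp A d q (i :: l) ϖ = braidOp A d q i (braidWordOp A d q l ϖ) := rfl

/-- The `ℓ`-root `α_{i,a} = (T̃_i π_{i,a})⁻¹ π_{i,a}`. -/
def lRoot (A : Matrix I I ℤ) (d : I → ℕ) (q : ℂˣ) (i : I) (a : ℂˣ) : LWeight I :=
  (braidOp A d q i (fundWeight i a))⁻¹ * fundWeight i a

/-- The monoid `𝒬⁺` generated by all the `ℓ`-roots `α_{i,a}`, `i ∈ I`, `a ∈ ℂˣ`. -/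
def lRootMonoid (A : Matrix I I ℤ) (d : I → ℕ) (q : ℂˣ) : Submonoid (LWeight I) :=
  Submonoid.closure {x | ∃ i a, x = lRoot A d q i a}

end Operators

/-! ### The root system and its Weyl group -/

section RootSystem

variable {ι k M N : Type*} [Field k] [AddCommGroup M] [Module k M]
  [AddCommGroup N] [Module k N] {P : RootPairing ι k M N}

/-- The Cartan matrix `A = (a_{ij})` in the convention `s_i(α_j) = α_j - a_{ij} α_i`, that is
`a_{ij} = ⟨α_j, α_i^∨⟩`. Mathlib's `RootPairing.Base.cartanMatrix` uses the transposed convention. -/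
def cartan [P.IsCrystallographic] (b : P.Base) : Matrix b.support b.support ℤ :=
  b.cartanMatrix.transpose

theorem reflection_simple [P.IsCrystallographic] (b : P.Base) (i j : b.support) :
    P.reflection i (P.root j) = P.root j - cartan b i j • P.root i :=
  P.reflection_apply_root' ℤ

/-- The set `R⁺ = R ∩ Q⁺` of positive roots. -/
def positiveRoots (b : P.Base) : Set M :=
  {x | x ∈ Set.range P.root ∧ x ∈ AddSubmonoid.closure (P.root '' b.support)}

/-- The element `s_{i₁} ⋯ s_{iₖ}` of the Weyl group. -/
def weylWord (b : P.Base) (l : List b.support) : P.weylGroup :=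
  (l.map fun i => RootPairing.weylGroup.ofIdx P (i : ι)).prod

/-- The word `(i₁, …, iₖ)` is a reduced expression of `w`: `s_{i₁} ⋯ s_{iₖ} = w`, and no shorter
word has this product. -/
def IsReducedExpr (b : P.Base) (w : P.weylGroup) (l : List b.support) : Prop :=
  weylWord b l = w ∧ ∀ l' : List b.support, weylWord b l' = w → l.length ≤ l'.length

end RootSystem

end EllRoot

end

/-! The idea is to lift the action to a free module and compare it there with the Weyl group. Let
the variable of `ℤ[X]` act on `ℓ`-weights by `u ↦ q u`, so that `X ^ n` sends `α_{j,a}` to `α_{j,q^n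
a}`. The operators `T̃_i` commute with this action and satisfy `T̃_i α_{j,a} = α_{j,a} + b_{ij}
α_{i,a}` (additively) with `b_{ij} ∈ ℤ[X]` (`braidOp_lRoot`). Thus `lRootEval` intertwines them with
the operators `polyOp` on `I → ℤ[X]`, and it maps vectors with nonnegative coefficients into `𝒬⁺`.
It suffices to show that `T_w e_i` has nonnegative coefficients; no injectivity of the evaluation is
needed.

This is proved in `pos_of_isShortest` by induction on the length of `w`. If `w ≠ 1`, let `j` be the
last letter of a reduced word; then `w α_j < 0`, so `j ≠ i`. Write `w = v u` with `u` in the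
dihedral group of `s_i, s_j` and `v` minimal in its coset. Since `w α_i > 0`, the word `u`
alternates, ends in `j` and is not the longest one. By the rank-two computation `T_u e_i` is a
combination of `e_i, e_j` with nonnegative coefficients, and induction applies to `T_v e_i` and `T_v
e_j`. Replacing the given word by that of `v u` is Matsumoto's theorem, `wordProd_eq_of_isShortest`.

The rank-two facts hold for a parameter `t`: `t = 1` gives the Weyl group, a power of `X` gives the
operators `T̃`. Coprimality of the `d_i` enters at multiple bonds, where it forces `d_i = 1` for the
short root. -/

open Polynomial

noncomputable section

namespace EllRoot

/-! ### Words, shortest words and dihedral relations. -/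

section Words

variable {I : Type*}

/-- The product of the word `l` in the letters `f i`. -/
def wordProd {E : Type*} [Monoid E] (f : I → E) (l : List I) : E := (l.map f).prod

section

variable {E : Type*} [Monoid E] (f : I → E)

@[simp] theorem wordProd_nil : wordProd f [] = 1 := rfl

@[simp] theorem wordProd_cons (i : I) (l : List I) :
    wordProd f (i :: l) = f i * wordProd f l := by simp [wordProd]

@[simp] theorem wordProd_append (l l' : List I) :
    wordProd f (l ++ l') = wordProd f l * wordProd f l' := by simp [wordProd]

/-- The alternating product `⋯ x y x y` with `k` factors, ending in `y`. -/
def altProd {E : Type*} [Monoid E] (x y : E) : ℕ → E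
  | 0 => 1
  | k + 1 => altProd y x k * y

/-- The alternating word `⋯ i j i j` with `k` letters, ending in `j`. -/
def altWord (i j : I) : ℕ → List I
  | 0 => []
  | k + 1 => altWord j i k ++ [j]

theorem wordProd_altWord (i j : I) (k : ℕ) :
    wordProd f (altWord i j k) = altProd (f i) (f j) k := by
  induction k generalizing i j with
  | zero => rfl
  | succ k ih => simp [altWord, altProd, ih]

@[simp] theorem length_altWord (i j : I) (k : ℕ) : (altWord i j k).length = k := by
  induction k generalizing i j with
  | zero => rfl
  | succ k ih => simp [altWord, ih]

/-- The word `l` is a shortest one among those with the same product. -/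
def IsShortest (l : List I) : Prop :=
  ∀ l', wordProd f l' = wordProd f l → l.length ≤ l'.length

variable {f}

theorem IsShortest.of_append_left {l l' : List I} (h : IsShortest f (l ++ l')) :
    IsShortest f l := by
  intro m hm
  have := h (m ++ l') (by simp [hm])
  simpa using this

theorem IsShortest.of_append_right {l l' : List I} (h : IsShortest f (l ++ l')) :
    IsShortest f l' := by
  intro m hm
  have := h (l ++ m) (by simp [hm])
  simpa using this

theorem IsShortest.of_wordProd_eq {l l' : List I} (h : IsShortest f l)
    (hl : wordProd f l' = wordProd f l) (hlen : l'.length = l.length) : IsShortest f l' := by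
  intro m hm
  rw [hlen]
  exact h m (hm.trans hl)

/-- The relations between two elements `x, y` that act as the simple reflections of a dihedral
group of order `2 m`: the braid relation of length `m`, and the positivity of all
`⋯ x y x y · α_x` and `⋯ y x y x · α_y` with fewer than `m` factors. Here `P z` and `Q z` express
the positivity of `z · α_x` and `z · α_y`. -/
structure Dihedral (x y : E) (P Q : E → Prop) (m : ℕ) : Prop where
  braid : altProd x y m = altProd y x m
  left : ∀ k < m, ∀ z, P z → Q z → P (z * altProd x y k)
  right : ∀ k < m, ∀ z, P z → Q z → Q (z * altProd y x k)

theorem Dihedral.symm {x y : E} {P Q : E → Prop} {m : ℕ} (h : Dihedral x y P Q m) :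
    Dihedral y x Q P m :=
  ⟨h.braid.symm, fun k hk z hP hQ => h.right k hk z hQ hP,
    fun k hk z hP hQ => h.left k hk z hQ hP⟩

end

/-! ### Abstract reflection systems: exchange, Matsumoto's theorem, transfer of positivity. -/

/-- Involutions `s i` generating a group, with a predicate `P g i` that stands for
`g αᵢ` being a positive root. -/
structure IsReflectionSystem {G : Type*} [Group G] (s : I → G) (P : G → I → Prop) : Prop where
  mul_self : ∀ i, s i * s i = 1
  pos_one : ∀ i, P 1 i
  pos_mul_iff : ∀ g i, P (g * s i) i ↔ ¬ P g i
  exchange : ∀ g i j, P g j → ¬ P (s i * g) j → s i * g = g * s j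

namespace IsReflectionSystem

variable {G : Type*} [Group G] {s : I → G} {P : G → I → Prop}

/-- Reading the word from the right, some letter first makes the image of `α_j` negative. The
exchange axiom moves that letter through to the end as `s j`, so right multiplication by `s j`
deletes it. -/
theorem exists_word_of_not_pos (hs : IsReflectionSystem s P) {l : List I} {j : I}
    (h : ¬ P (wordProd s l) j) :
    ∃ l' : List I, l'.length + 1 = l.length ∧ wordProd s l' = wordProd s l * s j := by
  induction l with
  | nil => exact absurd (hs.pos_one j) h
  | cons i l ih =>
    by_cases hl : P (wordProd s l) j
    · refine ⟨l, rfl, ?_⟩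
      rw [wordProd_cons] at h ⊢
      rw [hs.exchange _ i j hl h, mul_assoc, hs.mul_self, mul_one]
    · obtain ⟨l', hlen, hl'⟩ := ih hl
      exact ⟨i :: l', by simpa using hlen, by simp [hl', mul_assoc]⟩

theorem exists_isShortest_append_of_not_pos (hs : IsReflectionSystem s P) {l : List I} {j : I}
    (hl : IsShortest s l) (h : ¬ P (wordProd s l) j) :
    ∃ l' : List I, IsShortest s (l' ++ [j]) ∧ wordProd s (l' ++ [j]) = wordProd s l ∧
      l'.length + 1 = l.length := by
  obtain ⟨l', hlen, hl'⟩ := hs.exists_word_of_not_pos h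
  have hprod : wordProd s (l' ++ [j]) = wordProd s l := by
    simp [hl', mul_assoc, hs.mul_self]
  exact ⟨l', hl.of_wordProd_eq hprod (by simpa using hlen), hprod, hlen⟩

theorem pos_of_isShortest_append (hs : IsReflectionSystem s P) {l : List I} {j : I}
    (h : IsShortest s (l ++ [j])) : P (wordProd s l) j := by
  by_contra hneg
  obtain ⟨l', hlen, hl'⟩ := hs.exists_word_of_not_pos hneg
  have := h l' (by simpa using hl')
  simp at this
  omega

theorem not_pos_of_isShortest_append (hs : IsReflectionSystem s P) {l : List I} {j : I}
    (h : IsShortest s (l ++ [j])) : ¬ P (wordProd s (l ++ [j])) j := by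
  have := hs.pos_of_isShortest_append h
  simpa [hs.pos_mul_iff] using this

theorem not_isShortest_append_pair (hs : IsReflectionSystem s P) (l : List I) (j : I) :
    ¬ IsShortest s (l ++ [j] ++ [j]) := by
  intro h
  have := h l (by simp [hs.mul_self])
  simp at this

/-- A shortest word in two letters alternates. -/
theorem eq_altWord (hs : IsReflectionSystem s P) {i j : I} {u : List I}
    (hu : ∀ x ∈ u, x = i ∨ x = j) (h : IsShortest s u) :
    u = altWord i j u.length ∨ u = altWord j i u.length := by
  induction u using List.reverseRecOn with
  | nil => exact Or.inl rfl
  | append_singleton u x ih =>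
    have key : ∀ {i j : I}, x = j → u = altWord i j u.length →
        u ++ [x] = altWord i j (u ++ [x]).length := by
      rintro i j rfl hu'
      cases hn : u.length with
      | zero =>
        rw [List.length_eq_zero_iff.mp hn]
        rfl
      | succ n =>
        rw [hn] at hu'
        rw [hu', altWord] at h
        exact absurd h (hs.not_isShortest_append_pair _ _)
    have key' : ∀ {i j : I}, x = j → u = altWord j i u.length →
        u ++ [x] = altWord i j (u ++ [x]).length := by
      rintro i j rfl hu'
      rw [List.length_append, List.length_singleton, altWord, ← hu']
    have hx := hu x (by simp)
    rcases ih (fun y hy => hu y (by simp [hy])) h.of_append_left with hu' | hu'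
    · rcases hx with hx | hx
      · exact Or.inr (key' hx hu')
      · exact Or.inl (key hx hu')
    · rcases hx with hx | hx
      · exact Or.inr (key hx hu')
      · exact Or.inl (key' hx hu')

/-- Applying the braid relation to the first `m` letters makes them end in `j`, next to the final
`j`, and the two cancel. -/
theorem not_isShortest_altWord_succ (hs : IsReflectionSystem s P) {i j : I} {m : ℕ} (hm : 0 < m)
    (h : altProd (s i) (s j) m = altProd (s j) (s i) m) : ¬ IsShortest s (altWord i j (m + 1)) := by
  intro hsh
  obtain ⟨n, rfl⟩ : ∃ n, m = n + 1 := ⟨m - 1, by omega⟩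
  refine hs.not_isShortest_append_pair (altWord j i n) j (hsh.of_wordProd_eq ?_ (by simp))
  rw [altWord, wordProd_append _ (altWord j i (n + 1)), wordProd_append _ (altWord j i n ++ [j])]
  congr 1
  rw [wordProd_altWord, ← h, ← wordProd_altWord, altWord]

theorem altWord_suffix (i j : I) {k n : ℕ} (h : k ≤ n) : altWord i j k <:+ altWord i j n := by
  induction k generalizing i j n with
  | zero => exact List.nil_suffix
  | succ k ih =>
    obtain ⟨n, rfl⟩ : ∃ n', n = n' + 1 := ⟨n - 1, by omega⟩
    obtain ⟨t, ht⟩ := ih j i (n := n) (by omega)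
    exact ⟨t, by rw [altWord, altWord, ← ht, List.append_assoc]⟩

theorem le_of_isShortest_altWord (hs : IsReflectionSystem s P) {i j : I} {m k : ℕ} (hm : 0 < m)
    (h : altProd (s i) (s j) m = altProd (s j) (s i) m) (hk : IsShortest s (altWord i j k)) :
    k ≤ m := by
  by_contra hlt
  obtain ⟨t, ht⟩ := altWord_suffix i j (k := m + 1) (n := k) (by omega)
  rw [← ht] at hk
  exact hs.not_isShortest_altWord_succ hm h hk.of_append_right

/-- The decomposition of an element along a minimal representative of its coset by the subgroup
generated by `s i` and `s j`. -/
theorem exists_coset_decomposition (hs : IsReflectionSystem s P) (i j : I) {l : List I}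
    (hl : IsShortest s l) :
    ∃ v u : List I, (∀ x ∈ u, x = i ∨ x = j) ∧ IsShortest s (v ++ u) ∧
      wordProd s (v ++ u) = wordProd s l ∧ (v ++ u).length = l.length ∧
      P (wordProd s v) i ∧ P (wordProd s v) j := by
  induction hn : l.length generalizing l with
  | zero =>
    obtain rfl := List.length_eq_zero_iff.mp hn
    exact ⟨[], [], by simp, by simpa using hl, rfl, rfl, hs.pos_one i, hs.pos_one j⟩
  | succ n ih =>
    -- A right descent `x ∈ {i, j}` can be moved to the end of a shortest word and absorbed into
    -- `u`; the process stops when neither `i` nor `j` is a descent.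
    have key : ∀ x, (x = i ∨ x = j) → ¬ P (wordProd s l) x → ∃ v u : List I,
        (∀ x ∈ u, x = i ∨ x = j) ∧ IsShortest s (v ++ u) ∧
        wordProd s (v ++ u) = wordProd s l ∧ (v ++ u).length = n + 1 ∧
        P (wordProd s v) i ∧ P (wordProd s v) j := by
      intro x hx hneg
      obtain ⟨l', hsh, hprod, hlen⟩ := hs.exists_isShortest_append_of_not_pos hl hneg
      obtain ⟨v, u, hu, -, hvu', hvulen, hvi, hvj⟩ := ih hsh.of_append_left (by omega)
      have hprod' : wordProd s (v ++ (u ++ [x])) = wordProd s l := by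
        rw [← List.append_assoc, wordProd_append, hvu', ← hprod, wordProd_append]
      have hlen' : (v ++ (u ++ [x])).length = n + 1 := by
        rw [← List.append_assoc, List.length_append, hvulen, List.length_singleton]
      refine ⟨v, u ++ [x], ?_, hl.of_wordProd_eq hprod' (hlen'.trans hn.symm), hprod', hlen',
        hvi, hvj⟩
      intro y hy
      rcases List.mem_append.mp hy with hy | hy
      · exact hu y hy
      · rw [List.mem_singleton.mp hy]
        exact hx
    by_cases hi : P (wordProd s l) i
    · by_cases hj : P (wordProd s l) j
      · exact ⟨l, [], by simp, by simpa using hl, by simp, by simpa using hn, hi, hj⟩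
      · exact key j (Or.inr rfl) hj
    · exact key i (Or.inl rfl) hi

/-- An element with two descents `i, j` is a product of a minimal coset representative and the
longest element of the subgroup generated by `s i` and `s j`. -/
theorem exists_append_longest (hs : IsReflectionSystem s P) {i j : I} {m : ℕ} (hm : 0 < m)
    (hd : Dihedral (s i) (s j) (P · i) (P · j) m) {l : List I} (hl : IsShortest s l)
    (hi : ¬ P (wordProd s l) i) (hj : ¬ P (wordProd s l) j) :
    ∃ v : List I, v.length + m = l.length ∧
      wordProd s (v ++ altWord i j m) = wordProd s l := by
  obtain ⟨v, u, hu, hsh, hprod, hlen, hvi, hvj⟩ := hs.exists_coset_decomposition i j hl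
  have hush := hsh.of_append_right
  rcases hs.eq_altWord hu hush with hu' | hu'
  · have hum : u.length = m := by
      refine le_antisymm (hs.le_of_isShortest_altWord hm hd.braid (hu' ▸ hush)) ?_
      -- With fewer than `m` letters, `u` ending in `j` would keep `α_i` positive, against `hi`.
      by_contra hlt
      apply hi
      rw [← hprod, wordProd_append, hu', wordProd_altWord]
      exact hd.left _ (by omega) _ hvi hvj
    rw [hum] at hu'
    exact ⟨v, by rw [← hlen, List.length_append, hum], by rw [← hu', hprod]⟩
  · have hum : u.length = m := by
      refine le_antisymm (hs.le_of_isShortest_altWord hm hd.braid.symm (hu' ▸ hush)) ?_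
      by_contra hlt
      apply hj
      rw [← hprod, wordProd_append, hu', wordProd_altWord]
      exact hd.right _ (by omega) _ hvi hvj
    rw [hum] at hu'
    refine ⟨v, by rw [← hlen, List.length_append, hum], ?_⟩
    rw [← hprod, hu', wordProd_append, wordProd_append, wordProd_altWord, wordProd_altWord,
      hd.braid]

variable {E : Type*} [Monoid E] {f : I → E}

/-- Matsumoto's theorem: if the `f i` satisfy the braid relations then their product along a
shortest word depends only on the element represented by the word. -/
theorem wordProd_eq_of_isShortest (hs : IsReflectionSystem s P)
    (hd : ∀ i j, i ≠ j → ∃ m, 0 < m ∧ Dihedral (s i) (s j) (P · i) (P · j) m ∧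
      altProd (f i) (f j) m = altProd (f j) (f i) m)
    {l l' : List I} (hl : IsShortest s l) (hl' : IsShortest s l')
    (h : wordProd s l = wordProd s l') : wordProd f l = wordProd f l' := by
  induction hn : l.length generalizing l l' with
  | zero =>
    obtain rfl := List.length_eq_zero_iff.mp hn
    have := hl' [] h
    obtain rfl := List.length_eq_zero_iff.mp (Nat.le_zero.mp this)
    rfl
  | succ n ih =>
    have hlen : l'.length = n + 1 := hn ▸ le_antisymm (hl' _ h) (hl _ h.symm)
    obtain ⟨l, i, rfl⟩ := List.eq_nil_or_concat l |>.resolve_left (by rintro rfl; simp at hn)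
    obtain ⟨l', j, rfl⟩ := List.eq_nil_or_concat l' |>.resolve_left (by rintro rfl; simp at hlen)
    simp only [List.concat_eq_append] at *
    -- Two words with the same last letter are handled by cancelling it.
    have step : ∀ {v u : List I} {i : I}, IsShortest s (v ++ [i]) → IsShortest s (u ++ [i]) →
        wordProd s (v ++ [i]) = wordProd s (u ++ [i]) → (v ++ [i]).length = n + 1 →
        wordProd f (v ++ [i]) = wordProd f (u ++ [i]) := by
      intro v u i hv hu hvu hvlen
      rw [wordProd_append, wordProd_append, ih hv.of_append_left hu.of_append_left
        (by simpa using hvu) (by simpa using hvlen)]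
    rcases eq_or_ne i j with rfl | hij
    · exact step hl hl' h hn
    · obtain ⟨m, hm, hdij, hf⟩ := hd i j hij
      have hi := hs.not_pos_of_isShortest_append hl
      have hj := hs.not_pos_of_isShortest_append hl'
      rw [← h] at hj
      -- Both `i` and `j` are descents, so the element has shortest words `v ⋯ i j` and `v ⋯ j i`
      -- with alternating tails of length `m`. These agree under `f` by the braid relation, and each
      -- shares its last letter with one of the given words.
      obtain ⟨v, hvlen, hv⟩ := hs.exists_append_longest hm hdij hl hi hj
      have hv' : wordProd s (v ++ altWord j i m) = wordProd s (l ++ [i]) := by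
        rw [← hv, wordProd_append, wordProd_append, wordProd_altWord, wordProd_altWord,
          hdij.braid]
      have hvf : wordProd f (v ++ altWord j i m) = wordProd f (v ++ altWord i j m) := by
        rw [wordProd_append, wordProd_append, wordProd_altWord, wordProd_altWord, hf]
      have hsh : IsShortest s (v ++ altWord i j m) :=
        hl.of_wordProd_eq hv (by simpa using hvlen)
      have hsh' : IsShortest s (v ++ altWord j i m) :=
        hl.of_wordProd_eq hv' (by simpa using hvlen)
      obtain ⟨k, rfl⟩ : ∃ k, m = k + 1 := ⟨m - 1, by omega⟩
      rw [altWord, ← List.append_assoc] at hv hv' hsh hsh'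
      rw [altWord, altWord, ← List.append_assoc, ← List.append_assoc] at hvf
      rw [step hl hsh' hv'.symm hn, hvf]
      refine (step hl' hsh (h.symm.trans hv.symm) hlen).symm

/-- If the `f i` satisfy, with respect to a predicate `Q`, the same dihedral relations as the
`s i` do with respect to `P`, then positivity of `w αᵢ` implies that of the product of the `f i`
along any shortest word of `w`. -/
theorem pos_of_isShortest (hs : IsReflectionSystem s P) {Q : E → I → Prop} (hQ : ∀ i, Q 1 i)
    (hd : ∀ i j, i ≠ j → ∃ m, 0 < m ∧ Dihedral (s i) (s j) (P · i) (P · j) m ∧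
      Dihedral (f i) (f j) (Q · i) (Q · j) m)
    {l : List I} (hl : IsShortest s l) {i : I} (hi : P (wordProd s l) i) :
    Q (wordProd f l) i := by
  have matsumoto {l l' : List I} (hl : IsShortest s l) (hl' : IsShortest s l')
      (h : wordProd s l = wordProd s l') : wordProd f l = wordProd f l' :=
    hs.wordProd_eq_of_isShortest (fun i j hij =>
      let ⟨m, hm, h, h'⟩ := hd i j hij
      ⟨m, hm, h, h'.braid⟩) hl hl' h
  induction hn : l.length using Nat.strong_induction_on generalizing l i with
  | _ n ih =>
    rcases List.eq_nil_or_concat l with rfl | ⟨l, j, rfl⟩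
    · exact hQ i
    rw [List.concat_eq_append] at *
    have hj := hs.not_pos_of_isShortest_append hl
    have hij : i ≠ j := by
      rintro rfl
      exact hj hi
    obtain ⟨m, hm, hP, hQij⟩ := hd i j hij
    obtain ⟨v, u, hu, hsh, hprod, hlen, hvi, hvj⟩ := hs.exists_coset_decomposition i j hl
    rw [← hprod] at hi hj
    rw [matsumoto hl hsh hprod.symm]
    have hush := hsh.of_append_right
    -- The element sends `α_j` to a negative root while `v` does not, so `u` is nontrivial.
    have hu0 : u.length ≠ 0 := by
      intro h0
      obtain rfl := List.length_eq_zero_iff.mp h0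
      exact hj (by simpa using hvj)
    obtain ⟨k, hk⟩ := Nat.exists_eq_succ_of_ne_zero hu0
    have hvn : v.length < n := by
      rw [← hn, ← hlen, List.length_append]
      omega
    rcases hs.eq_altWord hu hush with hu' | hu'
    -- If `u` had length `m`, the braid relation would rewrite it to end in `i`, making `i` a
    -- descent.
    · have hum : u.length < m := by
        refine lt_of_le_of_ne (hs.le_of_isShortest_altWord hm hP.braid (hu' ▸ hush)) ?_
        rintro rfl
        have hprod' : wordProd s (v ++ altWord i j k ++ [i]) = wordProd s (v ++ u) := by
          have hbr := hP.braid
          rw [← wordProd_altWord, ← wordProd_altWord, ← hu', hk, altWord] at hbr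
          rw [List.append_assoc, wordProd_append, wordProd_append _ v u, hbr]
        refine hs.not_pos_of_isShortest_append (l := v ++ altWord i j k) (j := i)
          (hsh.of_wordProd_eq hprod' (by simp [hk])) ?_
        rwa [hprod']
      rw [wordProd_append, hu', wordProd_altWord]
      exact hQij.left _ hum _ (ih _ hvn hsh.of_append_left hvi rfl)
        (ih _ hvn hsh.of_append_left hvj rfl)
    · rw [hk, altWord] at hu'
      rw [hu', ← List.append_assoc] at hsh hi
      exact absurd hi (hs.not_pos_of_isShortest_append hsh)

end IsReflectionSystem

end Words

/-! ### Rank-two computations with a parameter `t`. -/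

section RankTwo

variable {R V : Type*} [CommRing R] [AddCommGroup V] [Module R V]
  {F G : Module.End R V} {x y : V} {φ ψ : V → R} {K : AddSubmonoid V} {t : R}

theorem dihedral_two (hF : ∀ v, F v = v + φ v • x) (hG : ∀ v, G v = v + ψ v • y)
    (hφy : φ y = 0) (hψx : ψ x = 0) :
    Dihedral F G (fun z => z x ∈ K) (fun z => z y ∈ K) 2 := by
  have hFy : F y = y := by rw [hF, hφy, zero_smul, add_zero]
  have hGx : G x = x := by rw [hG, hψx, zero_smul, add_zero]
  refine ⟨?_, ?_, ?_⟩
  · ext v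
    simp only [altProd, one_mul, Module.End.mul_apply]
    rw [hG v, hF v, map_add, map_add, map_smul, map_smul, hFy, hGx, hF v, hG v]
    module
  · intro k hk z hx hy
    interval_cases k <;> simpa [altProd, hGx] using hx
  · intro k hk z hx hy
    interval_cases k <;> simpa [altProd, hFy] using hy

/-- The alternating products take `x` to `x`, `x + t y`, `t y`: a deformation of the positive roots
of type `A₂`. -/
theorem dihedral_three (hF : ∀ v, F v = v + φ v • x) (hG : ∀ v, G v = v + ψ v • y)
    (hφx : φ x = -(1 + t ^ 2)) (hφy : φ y = t) (hψy : ψ y = -(1 + t ^ 2)) (hψx : ψ x = t)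
    (hK : ∀ v ∈ K, t • v ∈ K) :
    Dihedral F G (fun z => z x ∈ K) (fun z => z y ∈ K) 3 := by
  have hFx : F x = -t ^ 2 • x := by rw [hF, hφx]; module
  have hFy : F y = y + t • x := by rw [hF, hφy]
  have hGx : G x = x + t • y := by rw [hG, hψx]
  have hGy : G y = -t ^ 2 • y := by rw [hG, hψy]; module
  refine ⟨?_, ?_, ?_⟩
  · ext v
    simp only [altProd, one_mul, Module.End.mul_apply]
    rw [hF v, hG v]
    simp only [map_add, map_smul, hFx, hFy, hGx, hGy, hF v, hG v]
    module
  · intro k hk z hx hy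
    interval_cases k <;>
      simp only [altProd, one_mul, mul_one, Module.End.mul_apply, hGx, hFx, hFy, map_add,
        map_smul]
    · exact hx
    · exact add_mem hx (hK _ hy)
    · convert hK _ hy using 1
      module
  · intro k hk z hx hy
    interval_cases k <;>
      simp only [altProd, one_mul, mul_one, Module.End.mul_apply, hGx, hFy, hGy, map_add,
        map_smul]
    · exact hy
    · exact add_mem hy (hK _ hx)
    · convert hK _ hx using 1
      module

theorem pow_smul_mem (hK : ∀ v ∈ K, t • v ∈ K) (n : ℕ) {v : V} (hv : v ∈ K) : t ^ n • v ∈ K := by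
  induction n with
  | zero => simpa using hv
  | succ n ih => rw [pow_succ', mul_smul]; exact hK _ ih

/-- Type `B₂` with `x` short. The vectors supplied to `convert` are the images of `x` and `y` under
the alternating products; at `t = 1` they become positive roots. -/
theorem dihedral_four (hF : ∀ v, F v = v + φ v • x) (hG : ∀ v, G v = v + ψ v • y)
    (hφx : φ x = -(1 + t ^ 2)) (hφy : φ y = t ^ 3 + t) (hψy : ψ y = -(1 + t ^ 4)) (hψx : ψ x = t)
    (hK : ∀ v ∈ K, t • v ∈ K) :
    Dihedral F G (fun z => z x ∈ K) (fun z => z y ∈ K) 4 := by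
  have hFx : F x = -t ^ 2 • x := by rw [hF, hφx]; module
  have hFy : F y = y + (t ^ 3 + t) • x := by rw [hF, hφy]
  have hGx : G x = x + t • y := by rw [hG, hψx]
  have hGy : G y = -t ^ 4 • y := by rw [hG, hψy]; module
  have hK' (n : ℕ) {v : V} (hv : v ∈ K) : t ^ n • v ∈ K := pow_smul_mem hK n hv
  refine ⟨?_, ?_, ?_⟩
  · ext v
    simp only [altProd, one_mul, Module.End.mul_apply]
    rw [hF v, hG v]
    simp only [map_add, map_smul, hFx, hFy, hGx, hGy, hF v, hG v]
    module
  · intro k hk z hx hy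
    interval_cases k <;>
      simp only [altProd, one_mul, mul_one, Module.End.mul_apply, hGx, hFx, hFy, hGy, map_add,
        map_smul]
    · exact hx
    · exact add_mem hx (hK _ hy)
    · convert add_mem (hK' 4 hx) (hK _ hy) using 1
      module
    · convert hK' 4 hx using 1
      module
  · intro k hk z hx hy
    interval_cases k <;>
      simp only [altProd, one_mul, mul_one, Module.End.mul_apply, hGx, hFx, hFy, hGy, map_add,
        map_smul]
    · exact hy
    · convert add_mem hy (add_mem (hK' 3 hx) (hK _ hx)) using 1
      module
    · convert add_mem (hK' 2 hy) (add_mem (hK' 3 hx) (hK _ hx)) using 1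
      module
    · convert hK' 2 hy using 1
      module

/-- Type `G₂` with `x` short. The full orbits are computed: they end at `t ^ 10 • x` and `t ^ 6 •
y`, after passing through deformations of all short and all long positive roots. -/
theorem dihedral_six (hF : ∀ v, F v = v + φ v • x) (hG : ∀ v, G v = v + ψ v • y)
    (hφx : φ x = -(1 + t ^ 2)) (hφy : φ y = t ^ 5 + t ^ 3 + t) (hψy : ψ y = -(1 + t ^ 6))
    (hψx : ψ x = t) (hK : ∀ v ∈ K, t • v ∈ K) :
    Dihedral F G (fun z => z x ∈ K) (fun z => z y ∈ K) 6 := by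
  have hFx : F x = -t ^ 2 • x := by rw [hF, hφx]; module
  have hFy : F y = y + (t ^ 5 + t ^ 3 + t) • x := by rw [hF, hφy]
  have hGx : G x = x + t • y := by rw [hG, hψx]
  have hGy : G y = -t ^ 6 • y := by rw [hG, hψy]; module
  have hK' (n : ℕ) {v : V} (hv : v ∈ K) : t ^ n • v ∈ K := pow_smul_mem hK n hv
  refine ⟨?_, ?_, ?_⟩
  · ext v
    simp only [altProd, one_mul, Module.End.mul_apply]
    rw [hF v, hG v]
    simp only [map_add, map_smul, hFx, hFy, hGx, hGy, hF v, hG v]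
    module
  · intro k hk z hx hy
    interval_cases k <;>
      simp only [altProd, one_mul, mul_one, Module.End.mul_apply, hGx, hFx, hFy, hGy, map_add,
        map_smul]
    · exact hx
    · exact add_mem hx (hK _ hy)
    · convert add_mem (add_mem (hK' 6 hx) (hK' 4 hx)) (hK _ hy) using 1
      module
    · convert add_mem (add_mem (hK' 6 hx) (hK' 4 hx)) (hK' 5 hy) using 1
      module
    · convert add_mem (hK' 10 hx) (hK' 5 hy) using 1
      module
    · convert hK' 10 hx using 1
      module
  · intro k hk z hx hy
    interval_cases k <;>
      simp only [altProd, one_mul, mul_one, Module.End.mul_apply, hGx, hFx, hFy, hGy, map_add,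
        map_smul]
    · exact hy
    · convert add_mem hy (add_mem (add_mem (hK' 5 hx) (hK' 3 hx)) (hK _ hx)) using 1
      module
    · convert add_mem (add_mem (hK' 4 hy) (hK' 2 hy))
        (add_mem (add_mem (hK' 5 hx) (hK' 3 hx)) (hK _ hx)) using 1
      module
    · convert add_mem (add_mem (hK' 4 hy) (hK' 2 hy))
        (add_mem (add_mem (hK' 9 hx) (hK' 7 hx)) (hK' 5 hx)) using 1
      module
    · convert add_mem (hK' 6 hy) (add_mem (add_mem (hK' 9 hx) (hK' 7 hx)) (hK' 5 hx)) using 1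
      module
    · convert hK' 6 hy using 1
      module

end RankTwo

/-! ### Pulling dihedral relations back along a faithful representation. -/

section MapAlt

variable {G E : Type*} [Monoid G] [Monoid E]

theorem map_altProd (ρ : G →* E) (x y : G) (k : ℕ) :
    ρ (altProd x y k) = altProd (ρ x) (ρ y) k := by
  induction k generalizing x y with
  | zero => simp [altProd]
  | succ k ih => simp [altProd, ih]

theorem Dihedral.of_injective {ρ : G →* E} (hρ : Function.Injective ρ) {x y : G}
    {P Q : E → Prop} {m : ℕ} (h : Dihedral (ρ x) (ρ y) P Q m) :
    Dihedral x y (fun z => P (ρ z)) (fun z => Q (ρ z)) m := by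
  refine ⟨hρ ?_, fun k hk z hP hQ => ?_, fun k hk z hP hQ => ?_⟩
  · rw [map_altProd, map_altProd, h.braid]
  · rw [map_mul, map_altProd]
    exact h.left k hk _ hP hQ
  · rw [map_mul, map_altProd]
    exact h.right k hk _ hP hQ

end MapAlt

/-! ### The Weyl group as a reflection system; root lengths and symmetrizers. -/

section Weyl

variable {ι k M N : Type*} [Field k]
  [AddCommGroup M] [Module k M] [AddCommGroup N] [Module k N] {P : RootPairing ι k M N}

theorem weylGroupRootRep_injective : Function.Injective P.weylGroupRootRep := by
  intro g h hgh
  apply Subtype.ext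
  apply RootPairing.Equiv.weightHom_injective P
  ext v
  exact LinearMap.congr_fun hgh v

theorem weylGroupRootRep_ofIdx (i : ι) (v : M) :
    P.weylGroupRootRep (RootPairing.weylGroup.ofIdx P i) v = v + (-P.coroot' i v) • P.root i := by
  change P.reflection i v = _
  rw [P.reflection_apply]
  module

/-- This is `s_{gα} = g s_α g⁻¹`. An automorphism of the root pairing moves coroots compatibly with
roots, which gives `⟨g v, α_i^∨⟩ = ⟨v, α_j^∨⟩`. -/
theorem ofIdx_mul_eq_mul_ofIdx {g : P.weylGroup} {i j : ι} (h : g • P.root j = P.root i) :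
    RootPairing.weylGroup.ofIdx P i * g = g * RootPairing.weylGroup.ofIdx P j := by
  apply weylGroupRootRep_injective
  ext v
  rw [map_mul, map_mul, Module.End.mul_apply, Module.End.mul_apply, weylGroupRootRep_ofIdx,
    weylGroupRootRep_ofIdx, map_add, map_smul]
  have hidx : g.1.indexEquiv j = i :=
    P.root.injective (by
      rw [← h]
      exact (RootPairing.Hom.root_weightMap_apply _ _ _ _).symm)
  have hco : P.coroot' i (P.weylGroupRootRep g v) = P.coroot' j v := by
    have h1 := RootPairing.Hom.weight_coweight_transpose_apply P P (P.coroot i) g.1.toHom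
    have h2 := RootPairing.Hom.coroot_coweightMap_apply P P i g.1.toHom
    rw [← hidx, Equiv.symm_apply_apply, hidx] at h2
    rw [h2] at h1
    exact LinearMap.congr_fun h1 v
  have hr : P.weylGroupRootRep g (P.root j) = P.root i := h
  rw [hco, hr]

theorem wordProd_ofIdx (b : P.Base) (l : List b.support) :
    wordProd (fun i : b.support => RootPairing.weylGroup.ofIdx P (i : ι)) l = weylWord b l := by
  induction l with
  | nil => rfl
  | cons a l ih =>
    rw [wordProd_cons, ih]
    simp [weylWord]

theorem isShortest_of_isReducedExpr (b : P.Base) {w : P.weylGroup} {l : List b.support}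
    (h : IsReducedExpr b w l) :
    IsShortest (fun i : b.support => RootPairing.weylGroup.ofIdx P (i : ι)) l :=
  fun l' hl' => h.2 l' (by rw [← h.1, ← wordProd_ofIdx, ← wordProd_ofIdx, hl'])

variable [CharZero k]

theorem isPos_of_root_mem_closure (b : P.Base) {i : ι}
    (h : P.root i ∈ AddSubmonoid.closure (P.root '' b.support)) : b.IsPos i := by
  classical
  have key : ∀ m ∈ AddSubmonoid.closure (P.root '' b.support),
      ∃ f : ι → ℕ, m = ∑ j ∈ b.support, f j • P.root j := by
    intro m hm
    refine AddSubmonoid.closure_induction ?_ ⟨0, by simp⟩ ?_ hm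
    · rintro - ⟨j, hj, rfl⟩
      refine ⟨Pi.single j 1, ?_⟩
      rw [Finset.sum_eq_single_of_mem j hj (by simp_all)]
      simp
    · intro _ _ _ _ ⟨f, hf⟩ ⟨g, hg⟩
      exact ⟨f + g, by simp [hf, hg, add_smul, Finset.sum_add_distrib]⟩
  obtain ⟨f, hf⟩ := key _ h
  rw [b.isPos_iff', RootPairing.Base.height_eq_sum (f := fun j => (f j : ℤ)) (by simpa using hf)]
  exact Finset.sum_nonneg fun _ _ => Int.natCast_nonneg _

theorem root_mem_closure_iff (b : P.Base) {i : ι} :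
    P.root i ∈ AddSubmonoid.closure (P.root '' b.support) ↔ b.IsPos i := by
  let := P.indexNeg
  refine ⟨isPos_of_root_mem_closure b, fun h => ?_⟩
  refine (b.root_mem_or_neg_mem i).resolve_right fun hneg => ?_
  have : b.IsPos (-i) := isPos_of_root_mem_closure b (by simpa using hneg)
  exact (RootPairing.Base.IsPos.neg_iff_not b i).mp this h

theorem neg_root_mem_closure_iff (b : P.Base) (i : ι) :
    -P.root i ∈ AddSubmonoid.closure (P.root '' b.support) ↔
      P.root i ∉ AddSubmonoid.closure (P.root '' b.support) := by
  let := P.indexNeg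
  have := RootPairing.Base.IsPos.neg_iff_not b i
  rw [← root_mem_closure_iff, ← root_mem_closure_iff] at this
  simpa using this

/-- The exchange axiom holds because `s_i` permutes the positive roots other than `α_i`: if it makes
`g α_j` negative, then `g α_j = α_i`, and conjugation by `g` carries `s_j` to `s_i`. -/
theorem isReflectionSystem_weylGroup [Finite ι] [P.IsCrystallographic] [P.IsReduced]
    (b : P.Base) :
    IsReflectionSystem (fun i : b.support => RootPairing.weylGroup.ofIdx P (i : ι))
      (fun g i => P.weylGroupRootRep g (P.root i) ∈
        AddSubmonoid.closure (P.root '' b.support)) where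
  mul_self i := by
    apply weylGroupRootRep_injective
    ext v
    change P.reflection i (P.reflection i v) = v
    simp
  pos_one i := by
    rw [map_one]
    exact AddSubmonoid.subset_closure ⟨i, i.2, rfl⟩
  pos_mul_iff g i := by
    have h : P.weylGroupRootRep (RootPairing.weylGroup.ofIdx P (i : ι)) (P.root i) =
        -P.root i := P.reflection_apply_self i
    obtain ⟨j, hj⟩ : ∃ j, P.weylGroupRootRep g (P.root i) = P.root j :=
      ⟨_, P.weylGroup_apply_root g i⟩
    rw [map_mul, Module.End.mul_apply, h, map_neg, hj, neg_root_mem_closure_iff]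
  exchange g i j hpos hneg := by
    obtain ⟨l, hl⟩ : ∃ l, P.weylGroupRootRep g (P.root j) = P.root l :=
      ⟨_, P.weylGroup_apply_root g j⟩
    have h : P.weylGroupRootRep (RootPairing.weylGroup.ofIdx P (i : ι)) (P.root l) =
        P.root (P.reflectionPerm i l) := (P.root_reflectionPerm i l).symm
    rw [map_mul, Module.End.mul_apply, hl, h, root_mem_closure_iff] at hneg
    rw [hl, root_mem_closure_iff] at hpos
    have hli : l = i := by
      by_contra hne
      exact hneg (hpos.reflectionPerm i.2 hne)
    rw [hli] at hl
    exact ofIdx_mul_eq_mul_ofIdx hl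

variable [Finite ι] [P.IsCrystallographic] [P.IsReduced]

/-- The finite list of pairings of two roots `α ≠ ±β` is cut down by the sign condition on distinct
simple roots. -/
theorem cartan_mem (b : P.Base) {i j : b.support} (hij : i ≠ j) :
    (cartan b i j, cartan b j i) ∈
      ({(0, 0), (-1, -1), (-1, -2), (-2, -1), (-1, -3), (-3, -1)} : Set (ℤ × ℤ)) := by
  have h₀ : Module.IsReflexive k M := .of_isPerfPair P.toLinearMap
  have h := P.pairingIn_pairingIn_mem_set_of_isCrystal_of_isRed' (i := j) (j := i)
    (by simpa using fun h : (j : ι) = i => hij (Subtype.ext h).symm) (b.root_ne_neg_of_ne j.2 i.2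
      (fun h => hij (Subtype.ext h).symm))
  have h1 : P.pairingIn ℤ j i ≤ 0 := b.cartanMatrix_le_zero_of_ne j i hij.symm
  have hA : cartan b i j = P.pairingIn ℤ j i := rfl
  have hB : cartan b j i = P.pairingIn ℤ i j := rfl
  rw [hA, hB]
  generalize P.pairingIn ℤ j i = x at *
  generalize P.pairingIn ℤ i j = y at *
  simp only [Set.mem_insert_iff, Set.mem_singleton_iff, Prod.mk.injEq] at h ⊢
  omega

/-- Both `d` and the squared lengths symmetrize the Cartan matrix, so their ratio is constant along
each edge of the Dynkin diagram, which is connected by irreducibility. -/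
theorem symmetrizer_proportional [P.IsIrreducible] (b : P.Base) (d : b.support → ℕ)
    (hd : ∀ i j, (d i : ℤ) * cartan b i j = (d j : ℤ) * cartan b j i) (B : P.InvariantForm)
    (i j : b.support) :
    (d i : k) * B.form (P.root j) (P.root j) = d j * B.form (P.root i) (P.root i) := by
  refine b.induction_on_cartanMatrix (i := i) (j := j)
    (fun j => (d i : k) * B.form (P.root j) (P.root j) = d j * B.form (P.root i) (P.root i))
    rfl ?_
  intro l m hl hml
  have h1 : (d l : k) * P.pairing m l = d m * P.pairing l m := by
    have := congrArg (Int.cast : ℤ → k) (hd l m)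
    have hA : ((cartan b l m : ℤ) : k) = P.pairing m l := P.algebraMap_pairingIn ℤ m l
    have hB : ((cartan b m l : ℤ) : k) = P.pairing l m := P.algebraMap_pairingIn ℤ l m
    push_cast at this
    rwa [hA, hB] at this
  have h2 := B.pairing_mul_eq_pairing_mul_swap l m
  have h3 : P.pairing l m ≠ 0 := by
    rwa [ne_eq, ← b.cartanMatrix_apply_eq_zero_iff_pairing,
      b.cartanMatrix_apply_eq_zero_iff_symm]
  apply mul_left_cancel₀ h3
  linear_combination (-(d i : k)) * h2 + P.pairing m l * hl + B.form (P.root i) (P.root i) * h1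

/-- If `d j` is a proper multiple of `d i`, then `i` is short and `d i = 1`. -/
theorem symmetrizer_short [P.IsIrreducible] (b : P.Base) (d : b.support → ℕ)
    (hd_pos : ∀ i, 0 < d i)
    (hd : ∀ i j, (d i : ℤ) * cartan b i j = (d j : ℤ) * cartan b j i)
    (hd_coprime : ∀ m : ℕ, (∀ i, m ∣ d i) → m = 1) {i j : b.support} {c : ℕ} (hc : c ≠ 1)
    (hij : d j = c * d i) : d i = 1 := by
  have : Fintype ι := Fintype.ofFinite ι
  let B := (P.posRootForm ℤ).toInvariantForm
  have hprop := symmetrizer_proportional b d hd B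
  have hne : d j ≠ d i := by
    intro h
    rw [hij] at h
    exact hc (Nat.eq_of_mul_eq_mul_right (hd_pos i) (by simpa using h))
  have hd0 (l) : (d l : k) ≠ 0 := by exact_mod_cast (hd_pos l).ne'
  have hlen {l m : b.support} (h : B.form (P.root l) (P.root l) = B.form (P.root m) (P.root m)) :
      d l = d m := by
    have := hprop l m
    rw [h] at this
    exact_mod_cast mul_right_cancel₀ (B.ne_zero m) this
  apply hd_coprime
  intro l
  -- Only two root lengths occur, those of `α_i` and `α_j`, so every `d l` is `d i` or `c * d i`;
  -- hence `d i` is a common divisor.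
  rcases B.apply_eq_or_of_apply_ne (i := (i : ι)) (j := j)
    (fun h => hne (hlen h).symm) l with h | h
  · rw [hlen h]
  · rw [hlen h, hij]
    exact dvd_mul_left _ _

end Weyl

/-! ### Substitutions `u ↦ c u`. -/

theorem subst_coe (c : ℂˣ) (f : unitaryRatFunc) :
    ((subst c f : (RatFunc ℂ)ˣ) : RatFunc ℂ) = substRatFunc c ((f : (RatFunc ℂ)ˣ) : RatFunc ℂ) :=
  rfl

theorem subst_subst (c e : ℂˣ) (f : unitaryRatFunc) :
    subst c (subst e f) = subst (c * e) f := by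
  obtain ⟨f, p, r, hp, hr, hf⟩ := f
  apply Subtype.ext
  apply Units.ext
  rw [subst_coe, subst_coe, subst_coe]
  have hcomp (p : ℂ[X]) : (p.comp (C (e : ℂ) * X)).comp (C (c : ℂ) * X) =
      p.comp (C ((c * e : ℂˣ) : ℂ) * X) := by
    rw [comp_assoc]
    congr 1
    simp only [mul_comp, C_comp, X_comp, Units.val_mul, C_mul]
    ring
  change substRatFunc c (substRatFunc e (f : RatFunc ℂ)) = substRatFunc (c * e) (f : RatFunc ℂ)
  rw [hf]
  simp only [map_div₀, substRatFunc_algebraMap, hcomp]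

theorem subst_one (f : unitaryRatFunc) : subst 1 f = f := by
  obtain ⟨f, p, r, hp, hr, hf⟩ := f
  apply Subtype.ext
  apply Units.ext
  rw [subst_coe]
  change substRatFunc 1 (f : RatFunc ℂ) = (f : RatFunc ℂ)
  rw [hf]
  simp [map_div₀, substRatFunc_algebraMap]

theorem subst_oneSub (c a : ℂˣ) : subst c (oneSub a) = oneSub (c * a) := by
  apply Subtype.ext
  apply Units.ext
  rw [subst_coe]
  change substRatFunc c (algebraMap ℂ[X] (RatFunc ℂ) (1 - C (a : ℂ) * X)) =
    algebraMap ℂ[X] (RatFunc ℂ) (1 - C ((c * a : ℂˣ) : ℂ) * X)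
  rw [substRatFunc_algebraMap]
  congr 1
  simp only [sub_comp, one_comp, mul_comp, C_comp, X_comp, Units.val_mul, C_mul]
  ring

theorem subst_bondFactor (c q qi : ℂˣ) (e : ℤ) (f : unitaryRatFunc) :
    subst c (bondFactor q qi e f) = bondFactor q qi e (subst c f) := by
  unfold bondFactor
  split_ifs <;> simp [subst_subst, mul_comm]

/-! ### Lifting the braid operators to a free `ℤ[X]`-module. -/

section Operators

variable {I : Type*}

/-- The substitution `u ↦ c u` in all coordinates of an `ℓ`-weight. -/
def shift (c : ℂˣ) : LWeight I →* LWeight I where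
  toFun ϖ j := subst c (ϖ j)
  map_one' := by
    funext j
    simp
  map_mul' x y := by
    funext j
    simp

theorem shift_apply (c : ℂˣ) (ϖ : LWeight I) (j : I) : shift c ϖ j = subst c (ϖ j) := rfl

theorem shift_shift (c e : ℂˣ) (ϖ : LWeight I) : shift c (shift e ϖ) = shift (c * e) ϖ :=
  funext fun _ => subst_subst _ _ _

/-- An endomorphism of the `ℓ`-weight lattice, written additively. -/
def addEnd (f : LWeight I →* LWeight I) : Module.End ℤ (Additive (LWeight I)) :=
  (MonoidHom.toAdditive f).toIntLinearMap

/-- The action of a polynomial on the additively written `ℓ`-weight lattice, the variable acting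
by the substitution `u ↦ q u`. -/
def polyAct (q : ℂˣ) : ℤ[X] →ₐ[ℤ] Module.End ℤ (Additive (LWeight I)) :=
  aeval (addEnd (shift q))

theorem polyAct_X_pow (q : ℂˣ) (n : ℕ) (ϖ : LWeight I) :
    polyAct q (X ^ n) (Additive.ofMul ϖ) = Additive.ofMul (shift (q ^ n) ϖ) := by
  induction n with
  | zero =>
    rw [pow_zero, pow_zero, map_one]
    exact congrArg Additive.ofMul (funext fun j => (subst_one _).symm)
  | succ n ih =>
    rw [pow_succ', map_mul, Module.End.mul_apply, ih, polyAct, aeval_X, pow_succ',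
      ← shift_shift]
    rfl

variable (I) in
/-- The vectors of polynomials with nonnegative coefficients. -/
def nonnegCone : AddSubmonoid (I → ℤ[X]) where
  carrier := {v | ∀ j n, 0 ≤ (v j).coeff n}
  zero_mem' := by simp
  add_mem' hv hw j n := by
    rw [Pi.add_apply, coeff_add]
    exact add_nonneg (hv j n) (hw j n)

theorem X_smul_mem_nonnegCone {v : I → ℤ[X]} (hv : v ∈ nonnegCone I) :
    (X : ℤ[X]) • v ∈ nonnegCone I := by
  intro j n
  rw [Pi.smul_apply, smul_eq_mul]
  cases n with
  | zero => simp
  | succ n => simpa using hv j n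

variable [DecidableEq I] (A : Matrix I I ℤ) (d : I → ℕ) (q : ℂˣ)

theorem braidOp_apply (i j : I) (ϖ : LWeight I) : braidOp A d q i ϖ j =
    if j = i then (subst ((q ^ d i) ^ 2) (ϖ i))⁻¹
    else ϖ j * bondFactor q (q ^ d i) (A j i) (ϖ i) := rfl

theorem shift_braidOp (c : ℂˣ) (i : I) (ϖ : LWeight I) :
    shift c (braidOp A d q i ϖ) = braidOp A d q i (shift c ϖ) := by
  funext j
  rw [shift_apply, braidOp_apply, braidOp_apply]
  split_ifs
  · rw [map_inv, subst_subst, shift_apply, subst_subst, mul_comm]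
  · rw [map_mul, subst_bondFactor, shift_apply, shift_apply]

/-- The element `(T̃_i ϖ)⁻¹ ϖ`, where the only nontrivial coordinate of `ϖ` is the `i`-th one,
equal to `f`. -/
def lRootOf (i : I) : unitaryRatFunc →* LWeight I :=
  ((braidOp A d q i)⁻¹ * MonoidHom.id _).comp (MonoidHom.mulSingle (fun _ : I => unitaryRatFunc) i)

theorem lRootOf_apply (i : I) (f : unitaryRatFunc) :
    lRootOf A d q i f = (braidOp A d q i (Pi.mulSingle i f))⁻¹ * Pi.mulSingle i f := rfl

theorem lRootOf_oneSub (i : I) (a : ℂˣ) : lRootOf A d q i (oneSub a) = lRoot A d q i a := rfl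

theorem lRootOf_apply_self (i : I) (f : unitaryRatFunc) :
    lRootOf A d q i f i = subst ((q ^ d i) ^ 2) f * f := by
  rw [lRootOf_apply, Pi.mul_apply, Pi.inv_apply, braidOp_apply, if_pos rfl, Pi.mulSingle_eq_same,
    inv_inv]

theorem lRootOf_apply_of_ne {i j : I} (h : j ≠ i) (f : unitaryRatFunc) :
    lRootOf A d q i f j = (bondFactor q (q ^ d i) (A j i) f)⁻¹ := by
  rw [lRootOf_apply, Pi.mul_apply, Pi.inv_apply, braidOp_apply, if_neg h, Pi.mulSingle_eq_same,
    Pi.mulSingle_eq_of_ne h, one_mul, mul_one]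

/-- The analogue of `s_i λ = λ - ⟨λ, α_i^∨⟩ α_i`: the change made by `T̃_i` depends only on the
`i`-th coordinate. -/
theorem braidOp_eq (i : I) (ϖ : LWeight I) :
    braidOp A d q i ϖ = ϖ * (lRootOf A d q i (ϖ i))⁻¹ := by
  funext j
  rw [braidOp_apply, Pi.mul_apply, Pi.inv_apply]
  split_ifs with h
  · subst h
    rw [lRootOf_apply_self, mul_inv_rev, mul_inv_cancel_left]
  · rw [lRootOf_apply_of_ne A d q h, inv_inv]

theorem shift_lRoot (c : ℂˣ) (i : I) (a : ℂˣ) :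
    shift c (lRoot A d q i a) = lRoot A d q i (c * a) := by
  have h : shift c (fundWeight i a : LWeight I) = fundWeight i (c * a) := by
    funext j
    rw [shift_apply, fundWeight, fundWeight]
    rcases eq_or_ne j i with rfl | hj
    · rw [Pi.mulSingle_eq_same, Pi.mulSingle_eq_same, subst_oneSub]
    · rw [Pi.mulSingle_eq_of_ne hj, Pi.mulSingle_eq_of_ne hj, map_one]
  rw [lRoot, lRoot, map_mul, map_inv, shift_braidOp, h]

theorem polyAct_X_pow_lRoot (n : ℕ) (i : I) (a : ℂˣ) :
    polyAct q (X ^ n) (Additive.ofMul (lRoot A d q i a)) =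
      Additive.ofMul (lRoot A d q i (q ^ n * a)) := by
  rw [polyAct_X_pow, shift_lRoot]

/-- The coefficient of `α_i` in `T̃_i α_j - α_j`. -/
def bondPoly (i j : I) : ℤ[X] :=
  if i = j then -(1 + X ^ (2 * d i))
  else if A i j = -1 then X ^ d j
  else if A i j = -2 then X ^ 3 + X
  else if A i j = -3 then X ^ 5 + X ^ 3 + X
  else 0

/-- By `braidOp_eq` only the `i`-th coordinate of `α_{j,a}` matters. For `i ≠ j` it is the inverse
of the bond factor of `T̃_j`, whence `q_j`, that is `X ^ d j`, when `a_{ij} = -1`. -/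
theorem braidOp_lRoot (i j : I) (a : ℂˣ) :
    Additive.ofMul (braidOp A d q i (lRoot A d q j a)) =
      Additive.ofMul (lRoot A d q j a) +
        polyAct q (bondPoly A d i j) (Additive.ofMul (lRoot A d q i a)) := by
  have hX : polyAct q X (Additive.ofMul (lRoot A d q i a)) =
      Additive.ofMul (lRoot A d q i (q * a)) := by
    simpa using polyAct_X_pow_lRoot A d q 1 i a
  rw [braidOp_eq, ofMul_mul]
  congr 1
  rw [← lRootOf_oneSub A d q j, bondPoly]
  split_ifs with h
  · subst h
    rw [lRootOf_apply_self, map_neg, map_add, map_one, LinearMap.neg_apply,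
      LinearMap.add_apply, Module.End.one_apply, polyAct_X_pow_lRoot, subst_oneSub,
      map_mul, lRootOf_oneSub, lRootOf_oneSub, ofMul_inv, ofMul_mul, add_comm, ← pow_mul,
      mul_comm (d i)]
  all_goals rw [lRootOf_apply_of_ne A d q h, map_inv (lRootOf A d q i), inv_inv, bondFactor]
  · rw [if_pos ‹_›, subst_oneSub, polyAct_X_pow_lRoot, lRootOf_oneSub]
  · rw [if_neg ‹_›, if_pos ‹_›, MonoidHom.mul_apply, subst_oneSub, subst_oneSub, map_add,
      LinearMap.add_apply, polyAct_X_pow_lRoot, hX, map_mul (lRootOf A d q i),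
      lRootOf_oneSub, lRootOf_oneSub,
      ofMul_mul]
  · rw [if_neg ‹_›, if_neg ‹_›, if_pos ‹_›, MonoidHom.mul_apply, MonoidHom.mul_apply,
      subst_oneSub, subst_oneSub, subst_oneSub, map_add, map_add, LinearMap.add_apply,
      LinearMap.add_apply, polyAct_X_pow_lRoot, polyAct_X_pow_lRoot, hX,
      map_mul (lRootOf A d q i), map_mul (lRootOf A d q i),
      lRootOf_oneSub, lRootOf_oneSub, lRootOf_oneSub, ofMul_mul, ofMul_mul]
  · rw [if_neg ‹_›, if_neg ‹_›, if_neg ‹_›, MonoidHom.one_apply, map_one, map_zero]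
    rfl

theorem polyAct_braidOp (i : I) (p : ℤ[X]) (x : Additive (LWeight I)) :
    addEnd (braidOp A d q i) (polyAct q p x) =
      polyAct q p (addEnd (braidOp A d q i) x) := by
  have h : Commute (addEnd (braidOp A d q i))
      (polyAct q p) := by
    rw [polyAct]
    induction p using Polynomial.induction_on' with
    | add p r hp hr => rw [map_add]; exact hp.add_right hr
    | monomial n z =>
      rw [aeval_monomial]
      refine Commute.mul_right (Algebra.commutes z _).symm (Commute.pow_right ?_ n)
      exact LinearMap.ext fun x =>
        congrArg Additive.ofMul (shift_braidOp A d q q i x.toMul).symm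
  exact DFunLike.congr_fun h x

variable [Fintype I]

/-- The linear form `v ↦ ∑ j, b_{ij} v_j`. -/
def bondForm (i : I) : (I → ℤ[X]) →ₗ[ℤ[X]] ℤ[X] := ∑ j, bondPoly A d i j • LinearMap.proj j

theorem bondForm_apply (i : I) (v : I → ℤ[X]) :
    bondForm A d i v = ∑ j, bondPoly A d i j * v j := by
  simp [bondForm]

theorem bondForm_single (i j : I) : bondForm A d i (Pi.single j 1) = bondPoly A d i j := by
  rw [bondForm_apply, Finset.sum_eq_single j]
  · simp
  · intro m _ hm
    simp [hm]
  · simp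

/-- The operator `T̃_i` on the free module on the simple `ℓ`-roots. -/
def polyOp (i : I) : Module.End ℤ[X] (I → ℤ[X]) :=
  LinearMap.id + (bondForm A d i).smulRight (Pi.single i 1)

theorem polyOp_apply (i : I) (v : I → ℤ[X]) :
    polyOp A d i v = v + bondForm A d i v • Pi.single i 1 := rfl

/-- The additive map from the free module on the simple `ℓ`-roots to the `ℓ`-weight lattice that
sends the `i`-th basis vector to `α_{i,a}`. -/
def lRootEval (a : ℂˣ) : (I → ℤ[X]) →+ Additive (LWeight I) where
  toFun v := ∑ j, polyAct q (v j) (Additive.ofMul (lRoot A d q j a))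
  map_zero' := by simp
  map_add' v w := by simp [Finset.sum_add_distrib]

theorem lRootEval_apply (a : ℂˣ) (v : I → ℤ[X]) :
    lRootEval A d q a v = ∑ j, polyAct q (v j) (Additive.ofMul (lRoot A d q j a)) := rfl

theorem lRootEval_smul_single (a : ℂˣ) (i : I) (p : ℤ[X]) :
    lRootEval A d q a (p • Pi.single i 1) =
      polyAct q p (Additive.ofMul (lRoot A d q i a)) := by
  rw [lRootEval_apply, Finset.sum_eq_single i]
  · simp
  · intro m _ hm
    simp [hm]
  · simp

theorem lRootEval_polyOp (a : ℂˣ) (i : I) (v : I → ℤ[X]) :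
    lRootEval A d q a (polyOp A d i v) =
      addEnd (braidOp A d q i) (lRootEval A d q a v) := by
  rw [polyOp_apply, map_add, lRootEval_smul_single, bondForm_apply, lRootEval_apply, map_sum,
    map_sum, LinearMap.sum_apply, ← Finset.sum_add_distrib]
  refine Finset.sum_congr rfl fun j _ => ?_
  rw [polyAct_braidOp]
  change _ = polyAct q (v j) (Additive.ofMul (braidOp A d q i (lRoot A d q j a)))
  rw [braidOp_lRoot, map_add, mul_comm, map_mul, Module.End.mul_apply]

theorem lRootEval_wordProd (a : ℂˣ) (l : List I) (v : I → ℤ[X]) :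
    lRootEval A d q a (wordProd (polyOp A d) l v) =
      Additive.ofMul (braidWordOp A d q l (lRootEval A d q a v).toMul) := by
  induction l with
  | nil => rfl
  | cons i l ih =>
    rw [wordProd_cons, Module.End.mul_apply, lRootEval_polyOp, ih]
    rfl

/-- A term `m X ^ n` in coordinate `j` contributes the `m`-th power of `α_{j, q^n a}`, with `m` a
natural number. -/
theorem lRootEval_mem {v : I → ℤ[X]} (hv : v ∈ nonnegCone I) (a : ℂˣ) :
    (lRootEval A d q a v).toMul ∈ lRootMonoid A d q := by
  change lRootEval A d q a v ∈ (lRootMonoid A d q).toAddSubmonoid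
  rw [lRootEval_apply]
  refine sum_mem fun j _ => ?_
  rw [(v j).as_sum_support_C_mul_X_pow, map_sum, LinearMap.sum_apply]
  refine sum_mem fun n _ => ?_
  obtain ⟨m, hm⟩ := Int.eq_ofNat_of_zero_le (hv j n)
  rw [hm, map_mul, Module.End.mul_apply, polyAct_X_pow_lRoot]
  have : polyAct q (C ((m : ℕ) : ℤ)) = ((m : ℕ) : Module.End ℤ (Additive (LWeight I))) := by
    simp
  rw [this, Module.End.natCast_apply]
  have hmem : Additive.ofMul (lRoot A d q j (q ^ n * a)) ∈ (lRootMonoid A d q).toAddSubmonoid :=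
    Submonoid.subset_closure (s := {x | ∃ i a, x = lRoot A d q i a}) ⟨j, _, rfl⟩
  exact nsmul_mem hmem m

end Operators

/-! ### Matching dihedral relations for each pair of simple roots. -/

section Bonds

variable {ι k M N : Type*} [Field k]
  [AddCommGroup M] [Module k M] [AddCommGroup N] [Module k N]
  {P : RootPairing ι k M N}

theorem coroot'_root_self (i : ι) : P.coroot' i (P.root i) = 2 := by
  rw [P.root_coroot'_eq_pairing, P.pairing_same]

variable [P.IsCrystallographic]

theorem coroot'_root (b : P.Base) (i j : b.support) :
    P.coroot' i (P.root j) = (cartan b i j : k) := by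
  rw [P.root_coroot'_eq_pairing]
  exact (P.algebraMap_pairingIn ℤ j i).symm

variable [DecidableEq ι]

/-- For two simple roots, the simple reflections and the operators `T̃` satisfy the dihedral
relations of the same order. -/
def BondDihedral (b : P.Base) (d : b.support → ℕ) (i j : b.support) : Prop :=
  ∃ m, 0 < m ∧
    Dihedral (RootPairing.weylGroup.ofIdx P (i : ι)) (RootPairing.weylGroup.ofIdx P (j : ι))
      (fun g => P.weylGroupRootRep g (P.root i) ∈ AddSubmonoid.closure (P.root '' b.support))
      (fun g => P.weylGroupRootRep g (P.root j) ∈ AddSubmonoid.closure (P.root '' b.support)) m ∧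
    Dihedral (polyOp (cartan b) d i) (polyOp (cartan b) d j)
      (fun T => T (Pi.single i 1) ∈ nonnegCone b.support)
      (fun T => T (Pi.single j 1) ∈ nonnegCone b.support) m

theorem BondDihedral.symm {b : P.Base} {d : b.support → ℕ} {i j : b.support}
    (h : BondDihedral b d i j) : BondDihedral b d j i :=
  let ⟨m, hm, h, h'⟩ := h
  ⟨m, hm, h.symm, h'.symm⟩

/-- At a multiple bond `α_i` is the short root. There the exponents `1, 3, 5` of `q` in `T̃_i` are
not scaled by `d i`, so `hshort` must supply `d i = 1` before the rank-two lemma applies with `t =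
X`. At a simple bond `d i = d j` and `t = X ^ d i`. -/
theorem bondDihedral_of_cartan (b : P.Base) {d : b.support → ℕ} {i j : b.support} (hij : i ≠ j)
    (hd : (d i : ℤ) * cartan b i j = (d j : ℤ) * cartan b j i)
    (hshort : ∀ c : ℕ, c ≠ 1 → d j = c * d i → d i = 1)
    (h : (cartan b i j, cartan b j i) ∈
      ({(0, 0), (-1, -1), (-2, -1), (-3, -1)} : Set (ℤ × ℤ))) :
    BondDihedral b d i j := by
  have hs (i : b.support) (v : M) := weylGroupRootRep_ofIdx (P := P) (i : ι) v
  have hT (i : b.support) (v : b.support → ℤ[X]) := polyOp_apply (cartan b) d i v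
  have hTi (l : b.support) :
      bondForm (cartan b) d l (Pi.single l 1) = -(1 + X ^ (2 * d l)) := by
    rw [bondForm_single, bondPoly, if_pos rfl]
  have hTij (l m : b.support) (h : l ≠ m) : bondForm (cartan b) d l (Pi.single m 1) =
      if cartan b l m = -1 then X ^ d m
      else if cartan b l m = -2 then X ^ 3 + X
      else if cartan b l m = -3 then X ^ 5 + X ^ 3 + X
      else 0 := by
    rw [bondForm_single, bondPoly, if_neg h]
  have hC (v : M) (hv : v ∈ AddSubmonoid.closure (P.root '' b.support)) :
      (1 : k) • v ∈ AddSubmonoid.closure (P.root '' b.support) := by rwa [one_smul]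
  simp only [Set.mem_insert_iff, Set.mem_singleton_iff, Prod.mk.injEq] at h
  rcases h with ⟨h1, h2⟩ | ⟨h1, h2⟩ | ⟨h1, h2⟩ | ⟨h1, h2⟩
  · refine ⟨2, by norm_num, ?_, ?_⟩
    · refine Dihedral.of_injective weylGroupRootRep_injective (dihedral_two (hs i) (hs j) ?_ ?_)
      · rw [coroot'_root, h1]; simp
      · rw [coroot'_root, h2]; simp
    · refine dihedral_two (hT i) (hT j) ?_ ?_
      · rw [hTij i j hij, h1]; rfl
      · rw [hTij j i hij.symm, h2]; rfl
  · have hdd : d i = d j := by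
      rw [h1, h2] at hd
      omega
    refine ⟨3, by norm_num, ?_, ?_⟩
    · refine Dihedral.of_injective weylGroupRootRep_injective
        (dihedral_three (t := 1) (hs i) (hs j) ?_ ?_ ?_ ?_ hC)
      · rw [coroot'_root_self]; norm_num
      · rw [coroot'_root, h1]; simp
      · rw [coroot'_root_self]; norm_num
      · rw [coroot'_root, h2]; simp
    · refine dihedral_three (t := X ^ d i) (hT i) (hT j) ?_ ?_ ?_ ?_ ?_
      · rw [hTi]; ring
      · rw [hTij i j hij, h1, if_pos rfl, hdd]
      · rw [hTi, hdd]; ring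
      · rw [hTij j i hij.symm, h2, if_pos rfl]
      · exact fun v hv => pow_smul_mem (fun v hv => X_smul_mem_nonnegCone hv) _ hv
  · have hdd : d j = 2 * d i := by
      rw [h1, h2] at hd
      omega
    have hi := hshort 2 (by norm_num) hdd
    rw [hi] at hdd
    refine ⟨4, by norm_num, ?_, ?_⟩
    · refine Dihedral.of_injective weylGroupRootRep_injective
        (dihedral_four (t := 1) (hs i) (hs j) ?_ ?_ ?_ ?_ hC)
      · rw [coroot'_root_self]; norm_num
      · rw [coroot'_root, h1]; norm_num
      · rw [coroot'_root_self]; norm_num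
      · rw [coroot'_root, h2]; simp
    · refine dihedral_four (t := X) (hT i) (hT j) ?_ ?_ ?_ ?_ fun v => X_smul_mem_nonnegCone
      · rw [hTi, hi]
      · rw [hTij i j hij, h1]; rfl
      · rw [hTi, hdd]
      · rw [hTij j i hij.symm, h2, if_pos rfl, hi, pow_one]
  · have hdd : d j = 3 * d i := by
      rw [h1, h2] at hd
      omega
    have hi := hshort 3 (by norm_num) hdd
    rw [hi] at hdd
    refine ⟨6, by norm_num, ?_, ?_⟩
    · refine Dihedral.of_injective weylGroupRootRep_injective
        (dihedral_six (t := 1) (hs i) (hs j) ?_ ?_ ?_ ?_ hC)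
      · rw [coroot'_root_self]; norm_num
      · rw [coroot'_root, h1]; norm_num
      · rw [coroot'_root_self]; norm_num
      · rw [coroot'_root, h2]; simp
    · refine dihedral_six (t := X) (hT i) (hT j) ?_ ?_ ?_ ?_ fun v => X_smul_mem_nonnegCone
      · rw [hTi, hi]
      · rw [hTij i j hij, h1]; rfl
      · rw [hTi, hdd]
      · rw [hTij j i hij.symm, h2, if_pos rfl, hi, pow_one]

variable [Finite ι] [CharZero k] [P.IsReduced]

theorem bondDihedral [P.IsIrreducible] (b : P.Base) (d : b.support → ℕ) (hd_pos : ∀ i, 0 < d i)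
    (hd_symm : ∀ i j, (d i : ℤ) * cartan b i j = (d j : ℤ) * cartan b j i)
    (hd_coprime : ∀ m : ℕ, (∀ i, m ∣ d i) → m = 1) {i j : b.support} (hij : i ≠ j) :
    BondDihedral b d i j := by
  have hshort {i j : b.support} (c : ℕ) (hc : c ≠ 1) (h : d j = c * d i) : d i = 1 :=
    symmetrizer_short b d hd_pos hd_symm hd_coprime hc h
  have h := cartan_mem b hij
  by_cases h' : (cartan b i j, cartan b j i) ∈
      ({(0, 0), (-1, -1), (-2, -1), (-3, -1)} : Set (ℤ × ℤ))
  · exact bondDihedral_of_cartan b hij (hd_symm i j) hshort h'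
  · refine (bondDihedral_of_cartan b hij.symm (hd_symm j i) hshort ?_).symm
    simp only [Set.mem_insert_iff, Set.mem_singleton_iff, Prod.mk.injEq] at h h' ⊢
    omega

theorem single_mem_nonnegCone {I : Type*} [DecidableEq I] (i : I) :
    (Pi.single i 1 : I → ℤ[X]) ∈ nonnegCone I := by
  intro j n
  rcases eq_or_ne j i with rfl | h
  · rw [Pi.single_eq_same, coeff_one]
    split_ifs <;> norm_num
  · rw [Pi.single_eq_of_ne h, coeff_zero]

end Bonds

end EllRoot

end

theorem mainTheorem1 {ι k M N : Type*} [Finite ι] [DecidableEq ι] [Field k] [CharZero k]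
    [AddCommGroup M] [Module k M] [AddCommGroup N] [Module k N]
    (P : RootPairing ι k M N) [P.IsRootSystem] [P.IsCrystallographic] [P.IsReduced]
    [P.IsIrreducible] (b : P.Base)
    (d : b.support → ℕ) (hd_pos : ∀ i, 0 < d i)
    (hd_symm : ∀ i j, (d i : ℤ) * EllRoot.cartan b i j = (d j : ℤ) * EllRoot.cartan b j i)
    (hd_coprime : ∀ m : ℕ, (∀ i, m ∣ d i) → m = 1)
    (q : ℂˣ) (hq : ∀ m : ℕ, 0 < m → q ^ m ≠ 1)
    (w : P.weylGroup) (i : b.support) (hw : w • P.root i ∈ EllRoot.positiveRoots b)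
    (l : List b.support) (hl : EllRoot.IsReducedExpr b w l) (a : ℂˣ) :
    EllRoot.braidWordOp (EllRoot.cartan b) d q l (EllRoot.lRoot (EllRoot.cartan b) d q i a) ∈
      EllRoot.lRootMonoid (EllRoot.cartan b) d q := by
  have hpos := (EllRoot.isReflectionSystem_weylGroup b).pos_of_isShortest
    (f := EllRoot.polyOp (EllRoot.cartan b) d)
    (Q := fun T i => T (Pi.single i 1) ∈ EllRoot.nonnegCone b.support)
    EllRoot.single_mem_nonnegCone
    (fun i j hij => EllRoot.bondDihedral b d hd_pos hd_symm hd_coprime hij)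
    (EllRoot.isShortest_of_isReducedExpr b hl) (i := i)
    (by rw [EllRoot.wordProd_ofIdx, hl.1]; exact hw.2)
  have hmem := EllRoot.lRootEval_mem (EllRoot.cartan b) d q hpos a
  rw [EllRoot.lRootEval_wordProd] at hmem
  have heval : EllRoot.lRootEval (EllRoot.cartan b) d q a (Pi.single i 1) =
      Additive.ofMul (EllRoot.lRoot (EllRoot.cartan b) d q i a) := by
    have := EllRoot.lRootEval_smul_single (EllRoot.cartan b) d q a i 1
    rwa [one_smul, map_one] at this
  rwa [heval] at hmem
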